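/- **Setting.** Let $\mathbb K$ be a field (for instance $\mathbb C$). A 2-dimensional defect condition $\mathcal D$ consists of sets $D_2,D_1,D_0$ and maps $\psi_{1,2}\colon X_1\to D_2\times D_2$ and $\psi_{0,1}\colon X_0\to\bigsqcup_{m\ge0}X_1^m/C_m$, where $X_i=D_i\sqcup D_i^{-1}$, with $\psi_{1,2}(x^{-1})$ the swap of $\psi_{1,2}(x)$, with $\psi_{0,1}(u^{-1})$ the reversed word of inverses of $\psi_{0,1}(u)$, and with cyclically composable words $\psi_{0,1}(u)$. A *trivial surrounding theory* $T=T_0^{cw}$ for $\mathcal D$ exists only if $D_2=\{*\}$; it assigns $\mathbb K$ to $*$, a finite-dimensional vector space $X_x$ to $x\in D_1$ and $X_{x^{-1}}=X_x^*$ to $x^{-1}$, and to $u\in X_0$ with $\psi_{0,1}(u)=[(x_1,\dots,x_n)]$ a linear form $\mu_u\colon X_{x_1}\otimes\dots\otimes X_{x_n}\to\mathbb K$ that is invariant under cyclic permutation of the factors. A cell-decomposed circle with defects $U$ is an oriented circle divided into finitely many (at least one) 1-cells, each containing at most one point defect, in its interior and labelled by an element of $X_1$. A *bordism* $\Sigma\colon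 U\to V$ between finite disjoint unions of such circles is an oriented compact surface assembled from finitely many polygons by orientation-compatible gluing of pairs of sides, with oriented boundary $(-U)\sqcup V$ as cell-decomposed circles with defects; each polygon contains either (I) no defect, or (II) one defect line, labelled by some $x\in D_1$, which enters through one side and leaves through another one, or (III) one point defect labelled $u\in X_0$ joined to each of its $n\ge2$ sides by one defect line, the anticlockwise word of the sides being $\psi_{0,1}(u)$; labels agree along glued sides. (In words, a line labelled $x$ contributes $x$ if it is oriented into the polygon and $x^{-1}$ if it is oriented out of it. A point of $U$ (of $V$) labelled $x$ lies on a line labelled $x$ running into (out of) $\Sigma$.) Let $C_1(\Sigma)$, $C_2(\Sigma)$ be the sets of edges and polygons. For a side $e$ of a polygon $P$, with induced orientation $\mathfrak O$, put $Q_{(P,e,\mathfrak O)}=\mathbb K$ if no defect line crosses $e$, and $Q_{(P,e,\mathfrak O)}=X_x$ (resp. $X_x^*$) if a line labelled $x$ crosses $e$ into (resp. out of) $P$. For a 1-cell $e$ of $U$ or $V$ put $R_e=\mathbb K$ if it contains no defect and $R_e=X_x$ if it contains one labelled $x\in X_1$. Put $T(U)=\bigotimes_{e\in C_1(U)}R_e$,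 similarly $T(V)$, and $Q(\Sigma)=\bigotimes_{(P,e,\mathfrak O),\,e\not\subset U}Q_{(P,e,\mathfrak O)}$. - For an interior edge $e$, the propagator $\mathscr P_e\colon\mathbb K\to Q_{(P_1,e,\mathfrak O_1)}\otimes Q_{(P_2,e,\mathfrak O_2)}$ is $1\mapsto1\otimes1$ if no line crosses $e$, and otherwise $1\mapsto\sum_iv_i\otimes v_i^*$ for dual bases; for an edge $e$ of $V$, $\mathscr P_e\colon\mathbb K\to Q_{(P,e,\mathfrak O)}\otimes R_e$ is defined by the same formulas. Put $\mathscr P(\Sigma)=\bigotimes_{e\not\subset U}\mathscr P_e\colon\mathbb K\to Q(\Sigma)\otimes T(V)$. - For a polygon $P$, $\mathscr E_P\colon\bigotimes_{e\subset\partial P}Q_{(P,e,\mathfrak O)}\to\mathbb K$ is the product of all scalars in case (I), the product of all scalars and of the value of the covector on the vector in case (II), and $\mu_u$ in case (III). Put $\mathscr E(\Sigma)=\bigotimes_{P\in C_2(\Sigma)}\mathscr E_P\colon T(U)\otimes Q(\Sigma)\to\mathbb K$. Then $T(\Sigma)\colon T(U)\to T(V)$ is the composite $$T(U)\xrightarrow{\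 \mathbf 1\otimes\mathscr P(\Sigma)\ }T(U)\otimes Q(\Sigma)\otimes T(V)\xrightarrow{\ \mathscr E(\Sigma)\otimes\mathbf 1\ }T(V).$$ **Proposition.** Let $T_0^{cw}$ be a trivial surrounding theory and let $C_{uv}\colon U\to V$ be such a bordism from one circle to one circle whose underlying surface is a cylinder. Suppose that its cell decomposition splits it into two polygons $M$ and $\hat M$, where $\hat M\in C_2(C_{uv})$ is a single closed 2-cell that contains no point defects and meets no defect lines, that has exactly one edge $\hat e$ on $U$ and exactly one edge $\hat f$ on $V$, and all of whose other edges it shares with $M$, while $M$, the surface assembled from all the other 2-cells, is homeomorphic to a closed disc. Let $U_1$, $V_1$ be $U$, $V$ without $\hat e$, $\hat f$, let $T_0^{cw}(U_1)=\bigotimes_{e\in C_1(U_1)}R_e$ and $T_0^{cw}(V_1)=\bigotimes_{f\in C_1(V_1)}R_f$, let $Q(M)$ be the tensor product of the spaces $Q_{(P,e,\mathfrak O)}$ over all sides, not on $U$, of polygons $P\ne\hat M$, and put $$\mathscr P(M)=\bigotimes_{e\not\subset\hat M,\ e\not\subset U}\mathscr P_e\ \otimes\bigotimes_{e\subset M\cap\hat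 M}\mathscr P'_e\colon\ \mathbb K\to Q(M)\otimes T_0^{cw}(V_1),\qquad \mathscr E(M)=\bigotimes_{P\in C_2(C_{uv}),\,P\ne\hat M}\mathscr E_P,$$ where for an edge $e$ shared by $M$ and $\hat M$ the truncated propagator $\mathscr P'_e\colon\mathbb K\to Q_{(P(e),e,\mathfrak O)}=\mathbb K$, with $P(e)\neq\hat M$ the other polygon at $e$, is the identity. Let $T_0^{cw}(M)$ be the composite $$T_0^{cw}(U_1)\xrightarrow{\ \mathbf 1\otimes\mathscr P(M)\ }T_0^{cw}(U_1)\otimes Q(M)\otimes T_0^{cw}(V_1)\xrightarrow{\ \mathscr E(M)\otimes\mathbf 1\ }T_0^{cw}(V_1).$$ Then $T_0^{cw}(C_{uv})=T_0^{cw}(M)$ under the canonical identifications $T_0^{cw}(U)=T_0^{cw}(U_1)\otimes R_{\hat e}\cong T_0^{cw}(U_1)$ and $T_0^{cw}(V)=T_0^{cw}(V_1)\otimes R_{\hat f}\cong T_0^{cw}(V_1)$, where $R_{\hat e}=R_{\hat f}=\mathbb K$. -/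

import Mathlib

open scoped TensorProduct
open PiTensorProduct

/-! ### Defect conditions -/

/-- `X = D ⊔ D̄`: the elements `x` of `D` and their formal inverses `x⁻¹`. -/
inductive Signed (D : Type*) where
  | pos (x : D) : Signed D
  | neg (x : D) : Signed D

/-- The involution `x ↦ x⁻¹` of `D ⊔ D̄`. -/
def Signed.inv {D : Type*} : Signed D → Signed D
  | .pos x => .neg x
  | .neg x => .pos x

/-- A `2`-dimensional defect condition.  `psi12 x = (t x, s x)`, and `psi01` takes its values in
the cyclically composable words in `X₁ = D₁ ⊔ D̄₁`, up to rotation (`Cycle`). -/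
structure DefectConditions.{v} where
  D2 : Type v
  D1 : Type v
  D0 : Type v
  psi12 : Signed D1 → D2 × D2
  psi01 : Signed D0 → Cycle (Signed D1)
  psi12_inv : ∀ x, psi12 x.inv = (psi12 x).swap
  psi01_inv : ∀ u, psi01 u.inv = ((psi01 u).map Signed.inv).reverse
  composable : ∀ u, (psi01 u).Chain fun a b => (psi12 b).1 = (psi12 a).2

/-- The possible labels of an oriented `1`-cell: `none` if no defect line crosses it,
`some x` with `x ∈ X₁` if it is crossed by exactly one defect line. -/
abbrev DefectConditions.EdgeLabel (D : DefectConditions) := Option (Signed D.D1)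

/-- The label of an edge seen from its other side. -/
def DefectConditions.invLabel {D : DefectConditions} : D.EdgeLabel → D.EdgeLabel :=
  Option.map Signed.inv

/-! ### Cells of one-dimensional manifolds with defects -/

/-- The finite set `C₁(U)` of `1`-cells of a `1`-manifold with defects, where every cell contains
at most one point defect, in its interior; `label e = some x` if this defect is labelled
`x ∈ X₁`. -/
structure CellFamily (D : DefectConditions) where
  Cell : Type
  [finCell : Fintype Cell]
  label : Cell → D.EdgeLabel

attribute [instance] CellFamily.finCell

/-- The cells that satisfy `p`. -/
noncomputable def CellFamily.restrict {D : DefectConditions} (U : CellFamily D)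
    (p : U.Cell → Prop) : CellFamily D where
  Cell := {e : U.Cell // p e}
  finCell := Fintype.ofFinite _
  label e := U.label e.1

/-- A finite disjoint union of cell-decomposed oriented circles with defects. The `1`-cells of the
circle `c` are numbered by `Fin (len c)`, in the cyclic order given by its orientation. (The
two-dimensional labels of the arcs are omitted: they are only used when `D₂` is a singleton.) -/
structure DefectCircles (D : DefectConditions) where
  Circ : Type
  [finCirc : Fintype Circ]
  len : Circ → ℕ
  len_pos : ∀ c, 0 < len c
  label : (Σ c, Fin (len c)) → D.EdgeLabel

attribute [instance] DefectCircles.finCirc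

/-- The family of all `1`-cells of a disjoint union of circles with defects. -/
def DefectCircles.cells {D : DefectConditions} (U : DefectCircles D) : CellFamily D where
  Cell := Σ c, Fin (U.len c)
  label := U.label

/-! ### Basic-gons and surfaces assembled from them -/

/-- What a polygon with `n` sides contains. The sides are numbered anticlockwise, and `l i` is the
label read off at the side `i` *from inside the polygon*: it is `some x` if the side is crossed
by a line labelled `x` that is oriented into the polygon, `some x⁻¹` if that line is oriented out
of it.

* `empty`: no defects (type I);
* `strand x i j`: one line labelled `x`, entering through the side `i` and leaving through the
  side `j` (type II);
* `vertex u w`: one point defect labelled `u ∈ X₀`, joined to every side by exactly one line,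
  where `w` is the anticlockwise boundary word, which represents `ψ₀₁(u)` (type III). -/
inductive BasicGon (D : DefectConditions) {n : ℕ} (l : Fin n → D.EdgeLabel) where
  | empty (h : ∀ i, l i = none) : BasicGon D l
  | strand (x : D.D1) (i j : Fin n) (hij : i ≠ j)
      (hi : l i = some (.pos x)) (hj : l j = some (.neg x))
      (h : ∀ k, k ≠ i ∧ k ≠ j → l k = none) : BasicGon D l
  | vertex (u : Signed D.D0) (w : Fin n → Signed D.D1) (hn : 2 ≤ n)
      (hl : ∀ i, l i = some (w i))
      (hw : ((List.ofFn w : List (Signed D.D1)) : Cycle (Signed D.D1)) = D.psi01 u) : BasicGon D l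

/-- The polygon sides that are not in the in-boundary: an interior edge `e` gives two of them,
`(e, +)` (in the leftmost summand) and `(e, -)`, an edge of the out-boundary
and a free edge one each. -/
abbrev NonInSide (Out Int Free : Type) := ((Int ⊕ Out) ⊕ Int) ⊕ Free

/-- All polygon sides: those of the in-boundary, and the others. -/
abbrev PolySide (In Out Int Free : Type) := In ⊕ NonInSide Out Int Free

/-- An oriented compact surface assembled from finitely many basic-gons, with the cells of `U` as
in-boundary edges and the cells of `V` as out-boundary edges. Every interior edge is a side of
polygons exactly twice, with opposite orientations; every other edge exactly once. `Free` is the set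
of the edges on the boundary that belong neither to `U` nor to `V`; no defect line crosses them.

As in `BasicGon`, `label` gives the label of each polygon side as read off from inside its polygon.
A cell of `U` with label `x` is crossed by a line running into the surface,
a cell of `V` with label `x` by a line running out of it. -/
structure DefectComplex (D : DefectConditions) (U V : CellFamily D) where
  Poly : Type
  [finPoly : Fintype Poly]
  Int : Type
  [finInt : Fintype Int]
  Free : Type
  [finFree : Fintype Free]
  sides : Poly → ℕ
  sides_pos : ∀ P, 0 < sides P
  label : (Σ P, Fin (sides P)) → D.EdgeLabel
  content : ∀ P, BasicGon D (fun i => label ⟨P, i⟩)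
  place : PolySide U.Cell V.Cell Int Free → Σ P, Fin (sides P)
  place_bij : Function.Bijective place
  label_in : ∀ e, label (place (.inl e)) = U.label e
  label_out : ∀ f, label (place (.inr (.inl (.inl (.inr f))))) = D.invLabel (V.label f)
  label_neg : ∀ e, label (place (.inr (.inl (.inr e)))) =
    D.invLabel (label (place (.inr (.inl (.inl (.inl e))))))
  label_free : ∀ e, label (place (.inr (.inr e))) = none

attribute [instance] DefectComplex.finPoly DefectComplex.finInt DefectComplex.finFree

namespace DefectComplex

variable {D : DefectConditions} {U V : CellFamily D}

/-- The side of a polygon given by an edge of the in-boundary. -/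
def inSide (C : DefectComplex D U V) (e : U.Cell) : Σ P, Fin (C.sides P) := C.place (.inl e)

/-- The side of a polygon given by an edge of the out-boundary. -/
def outSide (C : DefectComplex D U V) (f : V.Cell) : Σ P, Fin (C.sides P) :=
  C.place (.inr (.inl (.inl (.inr f))))

/-- The first of the two sides `(e, +)`, `(e, -)` given by an interior edge. -/
def posSide (C : DefectComplex D U V) (e : C.Int) : Σ P, Fin (C.sides P) :=
  C.place (.inr (.inl (.inl (.inl e))))

/-- The second of the two sides `(e, +)`, `(e, -)` given by an interior edge. -/
def negSide (C : DefectComplex D U V) (e : C.Int) : Σ P, Fin (C.sides P) :=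
  C.place (.inr (.inl (.inr e)))

/-- The side of a polygon given by a free edge. -/
def freeSide (C : DefectComplex D U V) (e : C.Free) : Σ P, Fin (C.sides P) :=
  C.place (.inr (.inr e))

end DefectComplex

/-! ### The underlying stratified space -/

/-- The polygon with `n` sides is the closed unit disc; this is the point with parameter
`t ∈ [0,1]` on its side `i`, the arc of angles from `2π i / n` to `2π (i + 1) / n`. -/
noncomputable def sidePoint {n : ℕ} (i : Fin n) (t : unitInterval) :
    Metric.closedBall (0 : ℂ) 1 :=
  ⟨Complex.exp ((2 * Real.pi * ((i : ℝ) + t) / n : ℝ) * Complex.I), by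
    rw [mem_closedBall_zero_iff, Complex.norm_exp_ofReal_mul_I]⟩

/-- The midpoint of a side, where a defect line crosses it. -/
noncomputable def sideMidpoint {n : ℕ} (i : Fin n) : Metric.closedBall (0 : ℂ) 1 :=
  sidePoint i ⟨1 / 2, by norm_num, by norm_num⟩

/-- The point defects in a basic-gon. -/
def BasicGon.zeroStratum {D : DefectConditions} {n : ℕ} {l : Fin n → D.EdgeLabel} :
    BasicGon D l → Set (Metric.closedBall (0 : ℂ) 1)
  | .empty _ => ∅
  | .strand _ _ _ _ _ _ _ => ∅
  | .vertex _ _ _ _ _ => {z | (z : ℂ) = 0}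

/-- The defect lines in a basic-gon: nothing, a chord, or a star without its centre. -/
def BasicGon.oneStratum {D : DefectConditions} {n : ℕ} {l : Fin n → D.EdgeLabel} :
    BasicGon D l → Set (Metric.closedBall (0 : ℂ) 1)
  | .empty _ => ∅
  | .strand _ i j _ _ _ _ => {z | (z : ℂ) ∈ segment ℝ (sideMidpoint i : ℂ) (sideMidpoint j : ℂ)}
  | .vertex _ _ _ _ _ =>
      {z | (z : ℂ) ≠ 0 ∧ ∃ i : Fin n, (z : ℂ) ∈ segment ℝ 0 (sideMidpoint i : ℂ)}

namespace DefectComplex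

variable {D : DefectConditions} {U V : CellFamily D}

/-- The disjoint union of the polygons. -/
abbrev Points (C : DefectComplex D U V) := Σ _ : C.Poly, Metric.closedBall (0 : ℂ) 1

/-- The point with parameter `t` on a given polygon side. -/
noncomputable def pointOnSide (C : DefectComplex D U V) (s : Σ P, Fin (C.sides P))
    (t : unitInterval) : C.Points :=
  ⟨s.1, sidePoint s.2 t⟩

/-- The two sides given by an interior edge are glued, reversing their orientations. -/
inductive Glue (C : DefectComplex D U V) : C.Points → C.Points → Prop
  | glue (e : C.Int) (t : unitInterval) :
      Glue C (C.pointOnSide (C.posSide e) t) (C.pointOnSide (C.negSide e) (unitInterval.symm t))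

/-- The underlying surface: the polygons glued along the interior edges. -/
abbrev Surface (C : DefectComplex D U V) := Quot C.Glue

/-- The closed `2`-cell given by a polygon. -/
def cell (C : DefectComplex D U V) (P : C.Poly) : Set C.Surface :=
  Set.range fun z => Quot.mk C.Glue ⟨P, z⟩

/-- The set `Σ₀` of point defects of the surface. -/
def zeroStrata (C : DefectComplex D U V) : Set C.Surface :=
  ⋃ P, (fun z => Quot.mk C.Glue ⟨P, z⟩) '' (C.content P).zeroStratum

/-- The union `Σ₁` of the defect lines of the surface. -/
def oneStrata (C : DefectComplex D U V) : Set C.Surface :=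
  ⋃ P, (fun z => Quot.mk C.Glue ⟨P, z⟩) '' (C.content P).oneStratum

/-- The closed cell of `P` contains no defects. -/
def IsDefectFree (C : DefectComplex D U V) (P : C.Poly) : Prop :=
  Disjoint (C.cell P) (C.zeroStrata ∪ C.oneStrata)

theorem IsDefectFree.label_eq_none {C : DefectComplex D U V} {P : C.Poly}
    (hP : C.IsDefectFree P) (i : Fin (C.sides P)) : C.label ⟨P, i⟩ = none := by
  have key : ∀ z : Metric.closedBall (0 : ℂ) 1,
      z ∉ (C.content P).zeroStratum ∧ z ∉ (C.content P).oneStratum := by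
    refine fun z => ⟨fun hz => ?_, fun hz => ?_⟩
    · exact Set.disjoint_left.1 hP ⟨z, rfl⟩ (Or.inl (Set.mem_iUnion.2 ⟨P, z, hz, rfl⟩))
    · exact Set.disjoint_left.1 hP ⟨z, rfl⟩ (Or.inr (Set.mem_iUnion.2 ⟨P, z, hz, rfl⟩))
  rcases hc : C.content P with h | ⟨x, a, b, hab, ha, hb, h⟩ | ⟨u, w, hn, hl, hw⟩
  · exact h i
  · rw [hc] at key
    exact absurd (left_mem_segment ℝ _ _) (key (sideMidpoint a)).2
  · rw [hc] at key
    exact absurd rfl (key ⟨0, by simp⟩).1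

theorem IsDefectFree.label_eq_none_of_fst_eq {C : DefectComplex D U V} {P : C.Poly}
    (hP : C.IsDefectFree P) {s : Σ P, Fin (C.sides P)} (hs : s.1 = P) : C.label s = none := by
  obtain ⟨Q, i⟩ := s
  obtain rfl : Q = P := hs
  exact hP.label_eq_none i

end DefectComplex

/-- A bordism with defects and cell decomposition from `U` to `V`: a surface assembled from
basic-gons, whose oriented boundary is `(-U) ⊔ V`, with the given cell decompositions. Polygon sides
run anticlockwise; this is the orientation of `V` and the reversed one of `U`. -/
structure DefectBordism {D : DefectConditions} (U V : DefectCircles D) extends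
    DefectComplex D U.cells V.cells where
  no_free : IsEmpty Free
  in_boundary : ∀ (c : U.Circ) (i : Fin (U.len c)),
    (Quot.mk _ (toDefectComplex.pointOnSide (toDefectComplex.inSide ⟨c, i⟩) 0) :
      toDefectComplex.Surface) =
    Quot.mk _ (toDefectComplex.pointOnSide (toDefectComplex.inSide ⟨c, finRotate _ i⟩) 1)
  out_boundary : ∀ (c : V.Circ) (i : Fin (V.len c)),
    (Quot.mk _ (toDefectComplex.pointOnSide (toDefectComplex.outSide ⟨c, i⟩) 1) :
      toDefectComplex.Surface) =
    Quot.mk _ (toDefectComplex.pointOnSide (toDefectComplex.outSide ⟨c, finRotate _ i⟩) 0)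

/-- The bordism goes from one circle to one circle, and its underlying surface is a cylinder. -/
structure DefectBordism.IsCylinder {D : DefectConditions} {U V : DefectCircles D}
    (C : DefectBordism U V) : Prop where
  in_circle : Nonempty (Unique U.Circ)
  out_circle : Nonempty (Unique V.Circ)
  cylinder : Nonempty (C.Surface ≃ₜ Circle × unitInterval)

/-! ### Removing a defect-free polygon -/

namespace DefectComplex

variable {D : DefectConditions} {U V : CellFamily D}

/-- The in-boundary cells that are not on the polygon `P`. -/
noncomputable abbrev inAway (C : DefectComplex D U V) (P : C.Poly) : CellFamily D :=
  U.restrict fun e => (C.inSide e).1 ≠ P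

/-- The out-boundary cells that are not on the polygon `P`. -/
noncomputable abbrev outAway (C : DefectComplex D U V) (P : C.Poly) : CellFamily D :=
  V.restrict fun f => (C.outSide f).1 ≠ P

/-- The interior edges that remain interior when `P` is removed. -/
abbrev IntAway (C : DefectComplex D U V) (P : C.Poly) : Type :=
  {e : C.Int // (C.posSide e).1 ≠ P ∧ (C.negSide e).1 ≠ P}

/-- The edges that are free when `P` is removed: the old ones not on `P`, and the edges that
have one side on `P` and the other on a remaining polygon. -/
abbrev FreeAway (C : DefectComplex D U V) (P : C.Poly) : Type :=
  {e : C.Free // (C.freeSide e).1 ≠ P} ⊕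
    ({e : C.Int // (C.posSide e).1 ≠ P ∧ (C.negSide e).1 = P} ⊕
      {e : C.Int // (C.posSide e).1 = P ∧ (C.negSide e).1 ≠ P})

/-- The sides of the remaining polygons, as sides in the whole surface. -/
def oldSide (C : DefectComplex D U V) (P : C.Poly) :
    PolySide (C.inAway P).Cell (C.outAway P).Cell (C.IntAway P) (C.FreeAway P) →
      PolySide U.Cell V.Cell C.Int C.Free
  | .inl e => .inl e.1
  | .inr (.inl (.inl (.inl e))) => .inr (.inl (.inl (.inl e.1)))
  | .inr (.inl (.inl (.inr f))) => .inr (.inl (.inl (.inr f.1)))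
  | .inr (.inl (.inr e)) => .inr (.inl (.inr e.1))
  | .inr (.inr (.inl e)) => .inr (.inr e.1)
  | .inr (.inr (.inr (.inl e))) => .inr (.inl (.inl (.inl e.1)))
  | .inr (.inr (.inr (.inr e))) => .inr (.inl (.inr e.1))

theorem oldSide_ne (C : DefectComplex D U V) (P : C.Poly)
    (s : PolySide (C.inAway P).Cell (C.outAway P).Cell (C.IntAway P) (C.FreeAway P)) :
    (C.place (C.oldSide P s)).1 ≠ P := by
  rcases s with e | ((e | f) | e) | e | e | e
  · exact e.2
  · exact e.2.1
  · exact f.2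
  · exact e.2.2
  · exact e.2
  · exact e.2.1
  · exact e.2.2

theorem oldSide_injective (C : DefectComplex D U V) (P : C.Poly) :
    Function.Injective (C.oldSide P) := by
  rintro (e | ((e | f) | e) | e | e | e) (e' | ((e' | f') | e') | e' | e' | e') h <;>
    simp only [oldSide, Sum.inl.injEq, Sum.inr.injEq, reduceCtorEq] at h
  · exact congrArg _ (Subtype.ext h)
  · rw [Subtype.ext h]
  · exact absurd (h ▸ e'.2.2) e.2.2
  · rw [Subtype.ext h]
  · rw [Subtype.ext h]
  · exact absurd (h ▸ e'.2.1) e.2.1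
  · rw [Subtype.ext h]
  · exact absurd (h ▸ e.2.2) e'.2.2
  · rw [Subtype.ext h]
  · exact absurd (h ▸ e.2.1) e'.2.1
  · rw [Subtype.ext h]

theorem exists_oldSide (C : DefectComplex D U V) (P : C.Poly)
    (s : PolySide U.Cell V.Cell C.Int C.Free) (hs : (C.place s).1 ≠ P) :
    ∃ s', C.oldSide P s' = s := by
  rcases s with e | ((e | f) | e) | e
  · exact ⟨.inl ⟨e, hs⟩, rfl⟩
  · by_cases h : (C.negSide e).1 = P
    · exact ⟨.inr (.inr (.inr (.inl ⟨e, hs, h⟩))), rfl⟩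
    · exact ⟨.inr (.inl (.inl (.inl ⟨e, hs, h⟩))), rfl⟩
  · exact ⟨.inr (.inl (.inl (.inr ⟨f, hs⟩))), rfl⟩
  · by_cases h : (C.posSide e).1 = P
    · exact ⟨.inr (.inr (.inr (.inr ⟨e, h, hs⟩))), rfl⟩
    · exact ⟨.inr (.inl (.inr ⟨e, h, hs⟩)), rfl⟩
  · exact ⟨.inr (.inr (.inl ⟨e, hs⟩)), rfl⟩

/-- The surface assembled from all polygons except the defect-free polygon `P`. -/
noncomputable def remove (C : DefectComplex D U V) (P : C.Poly) (hP : C.IsDefectFree P) :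
    DefectComplex D (C.inAway P) (C.outAway P) where
  Poly := {P' : C.Poly // P' ≠ P}
  finPoly := Fintype.ofFinite _
  Int := C.IntAway P
  finInt := Fintype.ofFinite _
  Free := C.FreeAway P
  finFree := Fintype.ofFinite _
  sides P' := C.sides P'.1
  sides_pos P' := C.sides_pos P'.1
  label s := C.label ⟨s.1.1, s.2⟩
  content P' := C.content P'.1
  place s := ⟨⟨(C.place (C.oldSide P s)).1, C.oldSide_ne P s⟩, (C.place (C.oldSide P s)).2⟩
  place_bij := by
    constructor
    · intro s s' h
      apply C.oldSide_injective P
      apply C.place_bij.1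
      exact congrArg (fun x : (Σ P' : {P' : C.Poly // P' ≠ P}, Fin (C.sides P'.1)) =>
        (⟨x.1.1, x.2⟩ : Σ P', Fin (C.sides P'))) h
    · rintro ⟨⟨P', hP'⟩, i⟩
      obtain ⟨s, hs⟩ := C.place_bij.2 ⟨P', i⟩
      obtain ⟨s', rfl⟩ := C.exists_oldSide P s (by rw [hs]; exact hP')
      refine ⟨s', ?_⟩
      have key : ∀ (x : Σ P', Fin (C.sides P')) (hx : x.1 ≠ P), x = ⟨P', i⟩ →
          (⟨⟨x.1, hx⟩, x.2⟩ : Σ P' : {P' : C.Poly // P' ≠ P}, Fin (C.sides P'.1)) =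
            ⟨⟨P', hP'⟩, i⟩ := by
        rintro x hx rfl
        rfl
      exact key _ (C.oldSide_ne P s') hs
  label_in e := C.label_in e.1
  label_out f := C.label_out f.1
  label_neg e := C.label_neg e.1
  label_free e := by
    rcases e with e | e | e
    · exact C.label_free e.1
    · have h1 : C.label (C.negSide e.1) = none := hP.label_eq_none_of_fst_eq e.2.2
      have h2 : C.label (C.negSide e.1) = D.invLabel (C.label (C.posSide e.1)) :=
        C.label_neg e.1
      exact Option.map_eq_none_iff.1 (h2.symm.trans h1)
    · have h1 : C.label (C.posSide e.1) = none := hP.label_eq_none_of_fst_eq e.2.1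
      have h2 : C.label (C.negSide e.1) = D.invLabel (C.label (C.posSide e.1)) :=
        C.label_neg e.1
      exact h2.trans (by rw [h1]; rfl)

theorem inSide_label_eq_none {C : DefectComplex D U V} {P : C.Poly} (hP : C.IsDefectFree P)
    (e : U.Cell) (he : ¬ (C.inSide e).1 ≠ P) : U.label e = none := by
  rw [← C.label_in e]
  exact hP.label_eq_none_of_fst_eq (not_not.1 he)

theorem outSide_label_eq_none {C : DefectComplex D U V} {P : C.Poly} (hP : C.IsDefectFree P)
    (f : V.Cell) (hf : ¬ (C.outSide f).1 ≠ P) : V.label f = none := by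
  have h1 : C.label (C.outSide f) = none := hP.label_eq_none_of_fst_eq (not_not.1 hf)
  exact Option.map_eq_none_iff.1 ((C.label_out f).symm.trans h1)

end DefectComplex

/-- A decomposition of a bordism into two polygons `M` and `M̂`, where `M̂` is a single `2`-cell
that contains no defects, has exactly one edge on the in-boundary and exactly one on the
out-boundary, and shares all its other edges with `M`; `M` is the union of all other `2`-cells. -/
structure PolygonSplit {D : DefectConditions} {U V : DefectCircles D} (C : DefectBordism U V) where
  hat : C.Poly
  defectFree : C.IsDefectFree hat
  inCell : U.cells.Cell
  inSide_iff : ∀ e, (C.inSide e).1 = hat ↔ e = inCell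
  outCell : V.cells.Cell
  outSide_iff : ∀ f, (C.outSide f).1 = hat ↔ f = outCell
  shared : ∀ e, ¬ ((C.posSide e).1 = hat ∧ (C.negSide e).1 = hat)
  polygon : Nonempty ((C.remove hat defectFree).Surface ≃ₜ Metric.closedBall (0 : ℂ) 1)

/-! ### Canonical maps between tensor products -/

section Tensor

universe u
variable {K : Type u} [Field K] {ι : Type}

/-- `(⨂ᵢ Aᵢ) ⊗ (⨂ᵢ Bᵢ) → ⨂ᵢ (Aᵢ ⊗ Bᵢ)`, `(⨂ aᵢ) ⊗ (⨂ bᵢ) ↦ ⨂ (aᵢ ⊗ bᵢ)`. -/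
noncomputable def zipTensor (A B : ι → Type u) [∀ i, AddCommGroup (A i)] [∀ i, Module K (A i)]
    [∀ i, AddCommGroup (B i)] [∀ i, Module K (B i)] :
    (⨂[K] i, A i) ⊗[K] (⨂[K] i, B i) →ₗ[K] ⨂[K] i, (A i ⊗[K] B i) :=
  TensorProduct.lift (PiTensorProduct.map₂ fun i => TensorProduct.mk K (A i) (B i))

theorem zipTensor_bijective [Finite ι] (A B : ι → Type u) [∀ i, AddCommGroup (A i)]
    [∀ i, Module K (A i)] [∀ i, AddCommGroup (B i)] [∀ i, Module K (B i)] :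
    Function.Bijective (zipTensor (K := K) A B) := by
  let a := fun i => Module.Basis.ofVectorSpace K (A i)
  let b := fun i => Module.Basis.ofVectorSpace K (B i)
  let e : ((∀ i, Module.Basis.ofVectorSpaceIndex K (A i)) ×
      (∀ i, Module.Basis.ofVectorSpaceIndex K (B i))) ≃
      (∀ i, Module.Basis.ofVectorSpaceIndex K (A i) × Module.Basis.ofVectorSpaceIndex K (B i)) :=
    { toFun := fun p i => (p.1 i, p.2 i)
      invFun := fun q => (fun i => (q i).1, fun i => (q i).2)
      left_inv := fun _ => rfl
      right_inv := fun _ => rfl }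
  let b₁ := (Basis.piTensorProduct a).tensorProduct (Basis.piTensorProduct b)
  let b₂ := Basis.piTensorProduct fun i => (a i).tensorProduct (b i)
  have h : zipTensor (K := K) A B = (b₁.equiv b₂ e).toLinearMap := by
    refine b₁.ext fun p => ?_
    rw [LinearEquiv.coe_coe, Module.Basis.equiv_apply]
    simp only [b₁, b₂, Module.Basis.tensorProduct_apply', Basis.piTensorProduct_apply, zipTensor,
      TensorProduct.lift.tmul, PiTensorProduct.map₂_tprod_tprod, TensorProduct.mk_apply, e,
      Equiv.coe_fn_mk]
  rw [h]
  exact (b₁.equiv b₂ e).bijective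

/-- The canonical isomorphism `(⨂ᵢ Aᵢ) ⊗ (⨂ᵢ Bᵢ) ≃ ⨂ᵢ (Aᵢ ⊗ Bᵢ)`. -/
noncomputable def zipTensorEquiv [Finite ι] (A B : ι → Type u) [∀ i, AddCommGroup (A i)]
    [∀ i, Module K (A i)] [∀ i, AddCommGroup (B i)] [∀ i, Module K (B i)] :
    (⨂[K] i, A i) ⊗[K] (⨂[K] i, B i) ≃ₗ[K] ⨂[K] i, (A i ⊗[K] B i) :=
  LinearEquiv.ofBijective (zipTensor A B) (zipTensor_bijective A B)

theorem tprod_tprod_update {n : ι → ℕ} (F : (Σ P, Fin (n P)) → Type u)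
    [∀ x, AddCommGroup (F x)] [∀ x, Module K (F x)] [DecidableEq (Σ P, Fin (n P))]
    [DecidableEq ι] (v : ∀ x, F x) (x : Σ P, Fin (n P)) (c : F x) :
    (fun P => tprod K fun i => Function.update v x c ⟨P, i⟩) =
      Function.update (fun P => tprod K fun i => v ⟨P, i⟩) x.1
        (tprod K (Function.update (fun i => v ⟨x.1, i⟩) x.2 c)) := by
  obtain ⟨Q, k⟩ := x
  funext P
  by_cases hP : P = Q
  · subst hP
    rw [Function.update_self]
    congr 1
    funext i
    by_cases hi : i = k
    · subst hi
      simp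
    · rw [Function.update_of_ne hi, Function.update_of_ne]
      intro h
      exact hi (by simpa using h)
  · rw [Function.update_of_ne hP]
    congr 1
    funext i
    exact Function.update_of_ne (fun h => hP (congrArg Sigma.fst h)) c v

/-- The canonical map `⨂_{(P, i)} F(P, i) → ⨂_P ⨂_i F(P, i)` that groups the tensor factors. -/
noncomputable def groupTensor {n : ι → ℕ} (F : (Σ P, Fin (n P)) → Type u)
    [∀ x, AddCommGroup (F x)] [∀ x, Module K (F x)] :
    (⨂[K] x, F x) →ₗ[K] ⨂[K] P, ⨂[K] i : Fin (n P), F ⟨P, i⟩ :=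
  PiTensorProduct.lift
    { toFun := fun v => tprod K fun P => tprod K fun i => v ⟨P, i⟩
      map_update_add' := by
        classical
        intro inst v x a b
        simp only [tprod_tprod_update, MultilinearMap.map_update_add]
      map_update_smul' := by
        classical
        intro inst v x r a
        simp only [tprod_tprod_update, MultilinearMap.map_update_smul] }

/-- Multiplication `⨂ᵢ K → K`. -/
noncomputable def mulTensor (ι : Type) [Fintype ι] : (⨂[K] _ : ι, K) →ₗ[K] K :=
  PiTensorProduct.lift (MultilinearMap.mkPiAlgebra K ι K)

end Tensor

/-! ### Trivial surrounding theories -/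

universe u

/-- The state space of a line labelled `x ∈ X₁`: `X_x` for `x ∈ D₁`, and the dual of `X_x`
for `x⁻¹`. -/
def Signed.Space (K : Type u) [Field K] {D : Type*} (X : D → Type u)
    [∀ x, AddCommGroup (X x)] [∀ x, Module K (X x)] : Signed D → Type u
  | .pos x => X x
  | .neg x => Module.Dual K (X x)

namespace Signed

variable (K : Type u) [Field K] {D : Type*} (X : D → Type u) [∀ x, AddCommGroup (X x)]
  [∀ x, Module K (X x)]

noncomputable instance : ∀ x : Signed D, AddCommGroup (x.Space K X)
  | .pos x => inferInstanceAs (AddCommGroup (X x))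
  | .neg x => inferInstanceAs (AddCommGroup (Module.Dual K (X x)))

noncomputable instance : ∀ x : Signed D, Module K (x.Space K X)
  | .pos x => inferInstanceAs (Module K (X x))
  | .neg x => inferInstanceAs (Module K (Module.Dual K (X x)))

end Signed

/-- The data of a trivial surrounding theory: `D₂` is a singleton, to which the field `K` is
assigned; every `x ∈ D₁` is assigned a finite-dimensional vector space `X_x` (and `x⁻¹` its dual);
every `u ∈ X₀` is assigned, for every word `w` representing the cyclic word `ψ₀₁(u)`, a linear
form `μ_u` on `X_{w 1} ⊗ ⋯ ⊗ X_{w n}`, and these forms are invariant under cyclic permutations. -/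
structure TrivialSurroundingTheory (K : Type u) [Field K] (D : DefectConditions) where
  singleton : Nonempty (Unique D.D2)
  space : D.D1 → Type u
  [addCommGroup : ∀ x, AddCommGroup (space x)]
  [module : ∀ x, Module K (space x)]
  [finiteDimensional : ∀ x, FiniteDimensional K (space x)]
  junction : ∀ (u : Signed D.D0) {n : ℕ} (w : Fin n → Signed D.D1),
    ((List.ofFn w : List (Signed D.D1)) : Cycle (Signed D.D1)) = D.psi01 u →
      ((⨂[K] i, (w i).Space K space) →ₗ[K] K)
  junction_cyclic : ∀ (u : Signed D.D0) {n : ℕ} (w : Fin n → Signed D.D1)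
    (h : ((List.ofFn w : List (Signed D.D1)) : Cycle (Signed D.D1)) = D.psi01 u)
    (h' : ((List.ofFn fun i => w (finRotate n i) : List (Signed D.D1)) : Cycle (Signed D.D1)) =
      D.psi01 u) (v : ∀ i, (w i).Space K space),
    junction u (fun i => w (finRotate n i)) h' (tprod K fun i => v (finRotate n i)) =
      junction u w h (tprod K v)

attribute [instance] TrivialSurroundingTheory.addCommGroup TrivialSurroundingTheory.module
  TrivialSurroundingTheory.finiteDimensional

namespace TrivialSurroundingTheory

variable {K : Type u} [Field K] {D : DefectConditions} (T : TrivialSurroundingTheory K D)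

/-- The vector space of an edge: `K` if no line crosses it, and otherwise that of the line. -/
def Fiber : D.EdgeLabel → Type u
  | none => K
  | some x => x.Space K T.space

noncomputable instance : ∀ l : D.EdgeLabel, AddCommGroup (T.Fiber l)
  | none => inferInstanceAs (AddCommGroup K)
  | some x => inferInstanceAs (AddCommGroup (x.Space K T.space))

noncomputable instance : ∀ l : D.EdgeLabel, Module K (T.Fiber l)
  | none => inferInstanceAs (Module K K)
  | some x => inferInstanceAs (Module K (x.Space K T.space))

/-- The identification of the vector spaces of two equal labels. -/
noncomputable def fiberCast {l l' : D.EdgeLabel} (h : l = l') : T.Fiber l ≃ₗ[K] T.Fiber l' :=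
  h ▸ LinearEquiv.refl K (T.Fiber l)

/-- The value of the theory on a `1`-manifold: the tensor product of the spaces `R_e` of all its
`1`-cells. -/
abbrev obj (U : CellFamily D) : Type u := ⨂[K] e : U.Cell, T.Fiber (U.label e)

/-- The copairing `K → X ⊗ X*` of a label and its inverse, `1 ↦ 1 ⊗ 1` if there is no line and
`1 ↦ ∑ᵢ vᵢ ⊗ vᵢ*` otherwise. -/
noncomputable def copairing : ∀ l : D.EdgeLabel, K →ₗ[K] T.Fiber l ⊗[K] T.Fiber (D.invLabel l)
  | none => LinearMap.toSpanSingleton K (K ⊗[K] K) (1 ⊗ₜ 1)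
  | some (.pos x) => coevaluation K (T.space x)
  | some (.neg x) =>
      (TensorProduct.comm K (T.space x) (Module.Dual K (T.space x))).toLinearMap ∘ₗ
        coevaluation K (T.space x)

/-- The evaluation of a polygon crossed by one line: the product of all scalars with the pairing of
the covector and the vector at the two ends of the line. -/
noncomputable def evalStrand {n : ℕ} {l : Fin n → D.EdgeLabel} (x : D.D1) (i j : Fin n)
    (hij : i ≠ j) (hi : l i = some (.pos x)) (hj : l j = some (.neg x))
    (h : ∀ k, k ≠ i ∧ k ≠ j → l k = none) : MultilinearMap K (fun i => T.Fiber (l i)) K :=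
  let scalar : ∀ k : {k // k ≠ i ∧ k ≠ j}, T.Fiber (l k.1) →ₗ[K] K := fun k =>
    (T.fiberCast (h k.1 k.2)).toLinearMap
  let vector : T.Fiber (l i) →ₗ[K] T.space x := (T.fiberCast hi).toLinearMap
  let covector : T.Fiber (l j) →ₗ[K] Module.Dual K (T.space x) := (T.fiberCast hj).toLinearMap
  { toFun := fun v => (∏ k, scalar k (v k.1)) * covector (v j) (vector (v i))
    map_update_add' := by
      intro inst v m a b
      obtain rfl : inst = instDecidableEqFin n := Subsingleton.elim _ _
      by_cases hmi : m = i
      · subst hmi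
        have hs : ∀ c, ∀ k : {k // k ≠ m ∧ k ≠ j}, Function.update v m c k.1 = v k.1 :=
          fun c k => Function.update_of_ne k.2.1 c v
        simp only [hs, Function.update_self, Function.update_of_ne hij.symm, map_add, mul_add]
      · by_cases hmj : m = j
        · subst hmj
          have hs : ∀ c, ∀ k : {k // k ≠ i ∧ k ≠ m}, Function.update v m c k.1 = v k.1 :=
            fun c k => Function.update_of_ne k.2.2 c v
          simp only [hs, Function.update_self, Function.update_of_ne hij, map_add, mul_add,
            LinearMap.add_apply]
        · have hs : ∀ c, ∏ k, scalar k (Function.update v m c k.1) =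
              scalar ⟨m, hmi, hmj⟩ c * ∏ k ∈ Finset.univ.erase ⟨m, hmi, hmj⟩, scalar k (v k.1) := by
            intro c
            rw [← Finset.mul_prod_erase _ _ (Finset.mem_univ ⟨m, hmi, hmj⟩), Function.update_self]
            congr 1
            refine Finset.prod_congr rfl fun k hk => ?_
            rw [Function.update_of_ne fun e => Finset.ne_of_mem_erase hk (Subtype.ext e)]
          simp only [hs, Function.update_of_ne (Ne.symm hmi), Function.update_of_ne (Ne.symm hmj),
            map_add, add_mul]
    map_update_smul' := by
      intro inst v m r a
      obtain rfl : inst = instDecidableEqFin n := Subsingleton.elim _ _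
      by_cases hmi : m = i
      · subst hmi
        have hs : ∀ c, ∀ k : {k // k ≠ m ∧ k ≠ j}, Function.update v m c k.1 = v k.1 :=
          fun c k => Function.update_of_ne k.2.1 c v
        simp only [hs, Function.update_self, Function.update_of_ne hij.symm, map_smul,
          smul_eq_mul, mul_left_comm]
      · by_cases hmj : m = j
        · subst hmj
          have hs : ∀ c, ∀ k : {k // k ≠ i ∧ k ≠ m}, Function.update v m c k.1 = v k.1 :=
            fun c k => Function.update_of_ne k.2.2 c v
          simp only [hs, Function.update_self, Function.update_of_ne hij, map_smul,
            LinearMap.smul_apply, smul_eq_mul, mul_left_comm]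
        · have hs : ∀ c, ∏ k, scalar k (Function.update v m c k.1) =
              scalar ⟨m, hmi, hmj⟩ c * ∏ k ∈ Finset.univ.erase ⟨m, hmi, hmj⟩, scalar k (v k.1) := by
            intro c
            rw [← Finset.mul_prod_erase _ _ (Finset.mem_univ ⟨m, hmi, hmj⟩), Function.update_self]
            congr 1
            refine Finset.prod_congr rfl fun k hk => ?_
            rw [Function.update_of_ne fun e => Finset.ne_of_mem_erase hk (Subtype.ext e)]
          simp only [hs, Function.update_of_ne (Ne.symm hmi), Function.update_of_ne (Ne.symm hmj),
            map_smul, smul_eq_mul, mul_assoc] }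

/-- The evaluation `𝓔_P` of a basic-gon. -/
noncomputable def evalGon {n : ℕ} {l : Fin n → D.EdgeLabel} :
    BasicGon D l → ((⨂[K] i, T.Fiber (l i)) →ₗ[K] K)
  | .empty h => mulTensor (Fin n) ∘ₗ PiTensorProduct.map fun i =>
      (T.fiberCast (h i)).toLinearMap
  | .strand x i j hij hi hj h => PiTensorProduct.lift (T.evalStrand x i j hij hi hj h)
  | .vertex u w _ hl hw => T.junction u w hw ∘ₗ PiTensorProduct.map fun i =>
      (T.fiberCast (hl i)).toLinearMap

section StateSum

variable {U V : CellFamily D} (C : DefectComplex D U V)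

/-- The space `Q_{(P, e, 𝔒)}` of a side of a polygon. -/
abbrev sideSpace (s : PolySide U.Cell V.Cell C.Int C.Free) : Type u :=
  T.Fiber (C.label (C.place s))

/-- The space `Q`: the tensor product over all polygon sides that are not on the in-boundary. -/
abbrev Q : Type u := ⨂[K] s : NonInSide V.Cell C.Int C.Free, T.sideSpace C (.inr s)

/-- The first factor of the target of the propagator `𝓟_e` of an interior edge `e`
or an out-boundary edge `e`. -/
abbrev propFst (e : C.Int ⊕ V.Cell) : Type u := T.sideSpace C (.inr (.inl (.inl e)))

/-- The label of the second factor of the target of `𝓟_e`: for an interior edge, the other side;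
for an out-boundary edge, the edge itself as a cell of `V`. -/
def propSndLabel : C.Int ⊕ V.Cell → D.EdgeLabel
  | .inl e => C.label (C.negSide e)
  | .inr f => V.label f

/-- The second factor of the target of the propagator `𝓟_e`. -/
abbrev propSnd (e : C.Int ⊕ V.Cell) : Type u := T.Fiber (propSndLabel C e)

/-- The propagator `𝓟_e : K → Q_{(P₁, e, 𝔒₁)} ⊗ Q_{(P₂, e, 𝔒₂)}` of an interior edge, and
`𝓟_f : K → Q_{(P, f, 𝔒)} ⊗ R_f` of an out-boundary edge. -/
noncomputable def propEdge : ∀ e : C.Int ⊕ V.Cell, K →ₗ[K] T.propFst C e ⊗[K] T.propSnd C e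
  | .inl e => (LinearMap.lTensor _ (T.fiberCast (C.label_neg e).symm).toLinearMap) ∘ₗ
      T.copairing (C.label (C.posSide e))
  | .inr f => (LinearMap.rTensor _ (T.fiberCast (C.label_out f).symm).toLinearMap) ∘ₗ
      (TensorProduct.comm K _ _).toLinearMap ∘ₗ T.copairing (V.label f)

/-- The truncated propagator `𝓟'_e : K → Q_{(P, e, 𝔒)}` of a free edge, whose target is `K`:
it is the identity. -/
noncomputable def propFree (e : C.Free) : K →ₗ[K] T.sideSpace C (.inr (.inr e)) :=
  (T.fiberCast (C.label_free e).symm).toLinearMap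

/-- The tensor product of the propagators of all interior edges and all out-boundary edges. -/
noncomputable def propEdges : (⨂[K] e, T.propFst C e) ⊗[K] (⨂[K] e, T.propSnd C e) :=
  (zipTensorEquiv (T.propFst C) (T.propSnd C)).symm (tprod K fun e => T.propEdge C e 1)

/-- The tensor product of the truncated propagators of all free edges. -/
noncomputable def propFrees : ⨂[K] e : C.Free, T.sideSpace C (.inr (.inr e)) :=
  tprod K fun e => T.propFree C e 1

/-- The reordering of tensor factors that collects all factors `Q_{(P, e, 𝔒)}` in `Q`, and all
factors `R_f` in the space of the out-boundary. -/
noncomputable def collect :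
    ((⨂[K] e, T.propFst C e) ⊗[K] (⨂[K] e, T.propSnd C e)) ⊗[K]
      (⨂[K] e : C.Free, T.sideSpace C (.inr (.inr e))) ≃ₗ[K] T.Q C ⊗[K] T.obj V :=
  (TensorProduct.congr
    ((TensorProduct.congr (LinearEquiv.refl K _)
        (PiTensorProduct.tmulEquivDep K (T.propSnd C)).symm).trans
      (TensorProduct.assoc K _ _ _).symm)
    (LinearEquiv.refl K _)).trans <|
  (TensorProduct.rightComm K _ _ _).trans <|
  TensorProduct.congr
    ((TensorProduct.congr
      (PiTensorProduct.tmulEquivDep K fun s : (C.Int ⊕ V.Cell) ⊕ C.Int =>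
        T.sideSpace C (.inr (.inl s)))
      (LinearEquiv.refl K _)).trans
      (PiTensorProduct.tmulEquivDep K fun s : NonInSide V.Cell C.Int C.Free =>
        T.sideSpace C (.inr s)))
    (LinearEquiv.refl K _)

/-- The propagator `𝓟 : K → Q ⊗ T(V)`, the tensor product of the propagators of all edges that
are not on the in-boundary. -/
noncomputable def propagator : K →ₗ[K] T.Q C ⊗[K] T.obj V :=
  LinearMap.toSpanSingleton K _ (T.collect C (T.propEdges C ⊗ₜ T.propFrees C))

/-- The identification `T(U) ⊗ Q ≃ ⨂_{(P, i)} Q_{(P, i)}`, where `i` runs over the sides of the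
polygon `P`. -/
noncomputable def allSides :
    T.obj U ⊗[K] T.Q C ≃ₗ[K] ⨂[K] x : (Σ P, Fin (C.sides P)), T.Fiber (C.label x) :=
  (TensorProduct.congr
    (PiTensorProduct.congr fun e => T.fiberCast (C.label_in e).symm)
    (LinearEquiv.refl K _)).trans <|
  (PiTensorProduct.tmulEquivDep K (T.sideSpace C)).trans
    (PiTensorProduct.reindex K (fun x => T.Fiber (C.label x))
      (Equiv.ofBijective C.place C.place_bij).symm).symm

/-- The evaluation `𝓔 : T(U) ⊗ Q → K`, the tensor product of the evaluations of all polygons. -/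
noncomputable def evaluation : T.obj U ⊗[K] T.Q C →ₗ[K] K :=
  mulTensor C.Poly ∘ₗ (PiTensorProduct.map fun P => T.evalGon (C.content P)) ∘ₗ
    groupTensor (fun x => T.Fiber (C.label x)) ∘ₗ (T.allSides C).toLinearMap

/-- The value of the theory on a surface: the composite
`T(U) → T(U) ⊗ Q ⊗ T(V) → T(V)` of `1 ⊗ 𝓟` and `𝓔 ⊗ 1`. -/
noncomputable def map : T.obj U →ₗ[K] T.obj V :=
  (TensorProduct.lid K (T.obj V)).toLinearMap ∘ₗ
    LinearMap.rTensor (T.obj V) (T.evaluation C) ∘ₗ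
    (TensorProduct.assoc K (T.obj U) (T.Q C) (T.obj V)).symm.toLinearMap ∘ₗ
    LinearMap.lTensor (T.obj U) (T.propagator C) ∘ₗ
    (TensorProduct.rid K (T.obj U)).symm.toLinearMap

end StateSum

/-- If no line crosses the cells of `U` outside `p`, the canonical identification
`T(U) ≃ T(U₁) ⊗ T(U₂) ≃ T(U₁) ⊗ K ≃ T(U₁)`, where `U₁` consists of the cells that satisfy `p`, and
`U₂` of the others. -/
noncomputable def objRestrict (U : CellFamily D) (p : U.Cell → Prop)
    (h : ∀ e, ¬ p e → U.label e = none) : T.obj U ≃ₗ[K] T.obj (U.restrict p) := by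
  classical
  exact
  (PiTensorProduct.reindex K (fun e => T.Fiber (U.label e)) (Equiv.sumCompl p).symm).trans <|
  (PiTensorProduct.tmulEquivDep K fun s : {e // p e} ⊕ {e // ¬ p e} =>
    T.Fiber (U.label (Equiv.sumCompl p s))).symm.trans <|
  (TensorProduct.congr (LinearEquiv.refl K _)
    ((PiTensorProduct.congr fun e => T.fiberCast (h e.1 e.2)).trans
      (PiTensorProduct.constantBaseRingEquiv {e // ¬ p e} K).toLinearEquiv)).trans <|
  TensorProduct.rid K _

end TrivialSurroundingTheory

/-- The surface `M` of a decomposition: all polygons except `M̂`. It goes from the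
cells of `U` not on `M̂` to those of `V` not on `M̂`; the edges shared with `M̂` are free. -/
noncomputable abbrev PolygonSplit.rest {D : DefectConditions} {U V : DefectCircles D}
    {C : DefectBordism U V} (S : PolygonSplit C) :
    DefectComplex D (C.inAway S.hat) (C.outAway S.hat) :=
  C.remove S.hat S.defectFree

/-! ### Canonical maps on pure tensors -/

section Tensor

variable {K : Type u} [Field K]

/-! The value of the theory on a surface is a state sum. Once dual bases are chosen, each propagator
is a finite sum of pure tensors, and `map_tprod` writes the image of a pure tensor as a sum over all
assignments `j` of a basis index to every interior and out-boundary edge. The summand is the product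
of the evaluations of the polygons, times the pure tensor of the vectors left on the out-boundary.

Let `P` be a polygon free of defects. No line crosses its sides, so every edge at `P` has the space
`K` and a one-element index set, and all its vectors are the scalar `1`. Hence `P` evaluates to `1`
(`evalGon_unit`, `polyVec_eq_unit`), and the summands correspond bijectively to those of the surface
without `P` (`restrictIndex_bijective`). The other polygons receive the same vectors in both sums
(`polyVec_remove`): on an edge shared with `P`, the propagator `1 ⊗ 1` leaves the `1` that the
truncated propagator supplies. The boundary cells on `P` also carry `1`, which the canonical
identifications discard (`objRestrict_tprod`). So the two state sums agree term by term; this is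
`map_remove`, and the theorem is its case `P = S.hat`. -/

theorem mulTensor_map_tprod {ι : Type} [Fintype ι] {M : ι → Type u} [∀ i, AddCommGroup (M i)]
    [∀ i, Module K (M i)] (f : ∀ i, M i →ₗ[K] K) (v : ∀ i, M i) :
    mulTensor ι (PiTensorProduct.map f (PiTensorProduct.tprod K v)) = ∏ i, f i (v i) := by
  rw [PiTensorProduct.map_tprod, mulTensor, PiTensorProduct.lift.tprod,
    MultilinearMap.mkPiAlgebra_apply]

/-- The factors outside `p` are split off, turned into scalars by `f` and multiplied together. This
is the composite behind `objRestrict`, with arbitrary spaces `M i` and isomorphisms `f` in place of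
fibers and casts. -/
theorem restrictTensor_tprod {ι : Type} (p : ι → Prop) [DecidablePred p]
    [Fintype {i // ¬ p i}] {M : ι → Type u} [∀ i, AddCommGroup (M i)] [∀ i, Module K (M i)]
    (f : ∀ i : {i // ¬ p i}, M i.1 ≃ₗ[K] K) (v : ∀ i, M i) :
    TensorProduct.rid K _ (TensorProduct.congr (LinearEquiv.refl K _)
      ((PiTensorProduct.congr f).trans
        (PiTensorProduct.constantBaseRingEquiv {i // ¬ p i} K).toLinearEquiv)
      ((PiTensorProduct.tmulEquivDep K fun s : {i // p i} ⊕ {i // ¬ p i} =>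
        M (Equiv.sumCompl p s)).symm
        (PiTensorProduct.reindex K M (Equiv.sumCompl p).symm (PiTensorProduct.tprod K v)))) =
      (∏ i, f i (v i.1)) • PiTensorProduct.tprod K fun i : {i // p i} => v i.1 := by
  rw [PiTensorProduct.reindex_tprod]
  have h := PiTensorProduct.tmulEquivDep_symm_apply (R := K)
    (fun s : {i // p i} ⊕ {i // ¬ p i} => M (Equiv.sumCompl p s))
    (fun s => v (Equiv.sumCompl p s))
  refine (congrArg (fun x => TensorProduct.rid K _ (TensorProduct.congr (LinearEquiv.refl K _)
    ((PiTensorProduct.congr f).trans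
      (PiTensorProduct.constantBaseRingEquiv {i // ¬ p i} K).toLinearEquiv) x)) h).trans ?_
  refine (TensorProduct.rid_tmul _ _).trans ?_
  congr 1
  refine (congrArg (PiTensorProduct.constantBaseRingEquiv {i // ¬ p i} K)
    (PiTensorProduct.congr_tprod f fun i => v i.1)).trans ?_
  exact PiTensorProduct.constantBaseRingEquiv_tprod _

/-- The bracketing of the index type is that of `NonInSide`, as needed for the factor `Q` in
`collect`. -/
theorem tmulEquivDep_tmulEquivDep_tprod {ι₁ ι₂ ι₃ : Type} {M : (ι₁ ⊕ ι₂) ⊕ ι₃ → Type u}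
    [∀ i, AddCommGroup (M i)] [∀ i, Module K (M i)] (v : ∀ i, M i) :
    PiTensorProduct.tmulEquivDep K M
      (PiTensorProduct.tmulEquivDep K (fun s => M (.inl s))
        ((PiTensorProduct.tprod K fun i => v (.inl (.inl i))) ⊗ₜ[K]
          PiTensorProduct.tprod K fun i => v (.inl (.inr i))) ⊗ₜ[K]
        PiTensorProduct.tprod K fun i => v (.inr i)) = PiTensorProduct.tprod K v := by
  rw [PiTensorProduct.tmulEquivDep_apply, PiTensorProduct.tmulEquivDep_apply]
  congr 1
  funext s
  rcases s with (i | i) | i <;> rfl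

/-- Serves `allSides`, with `e` the bijection `place`. The families are compared through `ha` and
`hb` because `polyVec` is a transport along `place`, whose values are known only through
`polyVec_place`. -/
theorem reindex_symm_tmulEquivDep_tprod {ι₁ ι₂ ι : Type} {M : ι → Type u}
    [∀ i, AddCommGroup (M i)] [∀ i, Module K (M i)] (e : ι₁ ⊕ ι₂ ≃ ι) (v : ∀ i, M i)
    (a : ∀ i, M (e (.inl i))) (b : ∀ i, M (e (.inr i))) (ha : ∀ i, v (e (.inl i)) = a i)
    (hb : ∀ i, v (e (.inr i)) = b i) :
    (PiTensorProduct.reindex K M e.symm).symm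
      (PiTensorProduct.tmulEquivDep K (fun s => M (e s))
        (PiTensorProduct.tprod K a ⊗ₜ[K] PiTensorProduct.tprod K b)) =
      PiTensorProduct.tprod K v := by
  obtain rfl : (fun i => v (e (.inl i))) = a := funext ha
  obtain rfl : (fun i => v (e (.inr i))) = b := funext hb
  rw [LinearEquiv.symm_apply_eq, PiTensorProduct.reindex_tprod]
  refine (PiTensorProduct.tmulEquivDep_apply (R := K) (fun s => M (e s)) _ _).trans ?_
  congr 1
  funext s
  rcases s with i | i <;> rfl

/-- The contraction that ends the definition of `map`, for a propagator already written as a sum of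
pure tensors. -/
theorem lid_rTensor_assoc_symm_tmul_sum {M N W : Type u} [AddCommGroup M] [Module K M]
    [AddCommGroup N] [Module K N] [AddCommGroup W] [Module K W] {J : Type*} [Fintype J]
    (f : M ⊗[K] N →ₗ[K] K) (x : M) (a : J → N) (b : J → W) :
    TensorProduct.lid K W (LinearMap.rTensor W f ((TensorProduct.assoc K M N W).symm
      (x ⊗ₜ[K] ∑ j, a j ⊗ₜ[K] b j))) = ∑ j, f (x ⊗ₜ[K] a j) • b j := by
  simp only [TensorProduct.tmul_sum, map_sum, TensorProduct.assoc_symm_tmul,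
    LinearMap.rTensor_tmul, TensorProduct.lid_tmul]

end Tensor

/-! ### Edges without defect lines -/

namespace TrivialSurroundingTheory

variable {K : Type u} [Field K] {D : DefectConditions} (T : TrivialSurroundingTheory K D)

/-- The scalar `1` in the space of an edge that no line crosses. -/
noncomputable def unit {l : D.EdgeLabel} (h : l = none) : T.Fiber l :=
  T.fiberCast h.symm (1 : K)

/-- A cast depends only on its two end labels, so the scalar `1` of a fiber does not depend on the
chain of label equalities leading to it. -/
theorem fiberCast_trans {l l' l'' : D.EdgeLabel} (h : l = l') (h' : l' = l'') (v : T.Fiber l) :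
    T.fiberCast h' (T.fiberCast h v) = T.fiberCast (h.trans h') v := by
  subst h h'
  rfl

theorem fiberCast_unit {l l' : D.EdgeLabel} (h : l = l') (hl : l = none) :
    T.fiberCast h (T.unit hl) = T.unit (h.symm.trans hl) :=
  T.fiberCast_trans _ _ _

theorem fiberCast_unit_eq_one {l : D.EdgeLabel} (h hl : l = none) :
    T.fiberCast h (T.unit hl) = (1 : K) :=
  T.fiberCast_trans _ _ _

/-- A polygon whose sides are not crossed by lines evaluates to `1` on the tensor product of the
scalars `1`. -/
theorem evalGon_unit {n : ℕ} {l : Fin n → D.EdgeLabel} (c : BasicGon D l) (hl : ∀ i, l i = none)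
    (v : ∀ i, T.Fiber (l i)) (hv : ∀ i, v i = T.unit (hl i)) :
    T.evalGon c (PiTensorProduct.tprod K v) = 1 := by
  obtain rfl : v = fun i => T.unit (hl i) := funext hv
  rcases c with h | ⟨x, i, j, hij, hi, hj, h⟩ | ⟨u, w, hn, hw, hu⟩
  · refine (mulTensor_map_tprod (fun i => (T.fiberCast (h i)).toLinearMap) _).trans ?_
    exact Finset.prod_eq_one fun i _ => T.fiberCast_unit_eq_one (h i) (hl i)
  -- A strand crosses its side `i`, and a vertex has `n ≥ 2` sides, all of them crossed; neither is
  -- compatible with `hl`.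
  · exact absurd ((hl i).symm.trans hi) (by simp)
  · exact absurd ((hl ⟨0, by omega⟩).symm.trans (hw _)) (by simp)

/-- The scalar produced by the discarded cells is a product of ones. -/
theorem objRestrict_tprod (U : CellFamily D) (p : U.Cell → Prop)
    (h : ∀ e, ¬ p e → U.label e = none) (v : ∀ e, T.Fiber (U.label e))
    (hv : ∀ e (he : ¬ p e), v e = T.unit (h e he)) :
    T.objRestrict U p h (tprod K v) =
      tprod K fun e : (U.restrict p).Cell => (v e.1 : T.Fiber ((U.restrict p).label e)) := by
  classical
  refine (restrictTensor_tprod (M := fun e => T.Fiber (U.label e)) p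
    (fun e => T.fiberCast (h e.1 e.2)) v).trans ?_
  rw [Finset.prod_eq_one, one_smul]
  · rfl
  · rintro e -
    rw [hv e.1 e.2]
    exact T.fiberCast_unit_eq_one _ _

/-! ### Expansion of propagators in dual bases -/

/-- The index set of the sum that defines the copairing of a label. -/
def CopairingIndex : D.EdgeLabel → Type u
  | none => PUnit
  | some (.pos x) => Module.Basis.ofVectorSpaceIndex K (T.space x)
  | some (.neg x) => Module.Basis.ofVectorSpaceIndex K (T.space x)

noncomputable instance : ∀ l : D.EdgeLabel, Fintype (T.CopairingIndex l)
  | none => inferInstanceAs (Fintype PUnit)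
  | some (.pos x) => inferInstanceAs (Fintype (Module.Basis.ofVectorSpaceIndex K (T.space x)))
  | some (.neg x) => inferInstanceAs (Fintype (Module.Basis.ofVectorSpaceIndex K (T.space x)))

/-- The first factors of the summands of the copairing. -/
noncomputable def copairingFst : ∀ l : D.EdgeLabel, T.CopairingIndex l → T.Fiber l
  | none => fun _ => (1 : K)
  | some (.pos x) => fun i => Module.Basis.ofVectorSpace K (T.space x) i
  | some (.neg x) => fun i => (Module.Basis.ofVectorSpace K (T.space x)).coord i

/-- The second factors of the summands of the copairing. -/
noncomputable def copairingSnd : ∀ l : D.EdgeLabel, T.CopairingIndex l → T.Fiber (D.invLabel l)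
  | none => fun _ => (1 : K)
  | some (.pos x) => fun i => (Module.Basis.ofVectorSpace K (T.space x)).coord i
  | some (.neg x) => fun i => Module.Basis.ofVectorSpace K (T.space x) i

/-- Mathlib's `coevaluation` is expanded in the basis `ofVectorSpace`, hence that choice in the
index sets. For `x⁻¹` the two factors are swapped; for `none` there is the single term `1 ⊗ 1`. -/
theorem copairing_one : ∀ l : D.EdgeLabel,
    T.copairing l 1 = ∑ i, T.copairingFst l i ⊗ₜ[K] T.copairingSnd l i
  | none => (LinearMap.toSpanSingleton_apply_one K (K ⊗[K] K) (1 ⊗ₜ 1)).trans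
      (Fintype.sum_unique (M := K ⊗[K] K) (ι := PUnit) fun _ => (1 : K) ⊗ₜ[K] (1 : K)).symm
  | some (.pos x) => coevaluation_apply_one K (T.space x)
  | some (.neg x) => by
      change TensorProduct.comm K _ _ (coevaluation K (T.space x) 1) = _
      rw [coevaluation_apply_one]
      simp only [map_sum, TensorProduct.comm_tmul]
      rfl

/-- An edge without a line contributes a single summand, so it can be dropped from the index of the
state sum. -/
theorem nonempty_unique_copairingIndex {l : D.EdgeLabel} (h : l = none) :
    Nonempty (Unique (T.CopairingIndex l)) := by
  subst h
  exact ⟨inferInstanceAs (Unique PUnit)⟩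

theorem copairingFst_eq_unit {l : D.EdgeLabel} (h : l = none) (i : T.CopairingIndex l) :
    T.copairingFst l i = T.unit h := by
  subst h
  rfl

theorem copairingSnd_eq_unit {l : D.EdgeLabel} (h : l = none) (i : T.CopairingIndex l) :
    T.copairingSnd l i = T.unit (l := D.invLabel l) (by rw [h]; rfl) := by
  subst h
  rfl

/-! ### The state sum of a surface. -/

section Expansion

variable {U V : CellFamily D} (C : DefectComplex D U V)

/-- The label whose copairing is the propagator of an edge. -/
def propLabel : C.Int ⊕ V.Cell → D.EdgeLabel
  | .inl e => C.label (C.posSide e)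
  | .inr f => V.label f

/-- The index set of the sum that defines the propagator of an edge. -/
abbrev PropIndex (e : C.Int ⊕ V.Cell) : Type u := T.CopairingIndex (propLabel C e)

/-- The first factors of the summands of the propagator of an edge. -/
noncomputable def propVecFst : ∀ e : C.Int ⊕ V.Cell, T.PropIndex C e → T.propFst C e
  | .inl e => T.copairingFst (C.label (C.posSide e))
  | .inr f => fun j => T.fiberCast (C.label_out f).symm (T.copairingSnd (V.label f) j)

/-- The second factors of the summands of the propagator of an edge. -/
noncomputable def propVecSnd : ∀ e : C.Int ⊕ V.Cell, T.PropIndex C e → T.propSnd C e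
  | .inl e => fun j =>
      T.fiberCast (C.label_neg e).symm (T.copairingSnd (C.label (C.posSide e)) j)
  | .inr f => T.copairingFst (V.label f)

theorem propEdge_one (e : C.Int ⊕ V.Cell) :
    T.propEdge C e 1 = ∑ j, T.propVecFst C e j ⊗ₜ[K] T.propVecSnd C e j := by
  rcases e with e | f
  · change LinearMap.lTensor _ _ (T.copairing (C.label (C.posSide e)) 1) = _
    rw [copairing_one, map_sum]
    rfl
  · change LinearMap.rTensor _ _ (TensorProduct.comm K _ _ (T.copairing (V.label f) 1)) = _
    rw [copairing_one, map_sum, map_sum]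
    rfl

/-- Multilinearity of `tprod` turns a tensor product of sums into a sum over choice functions `j`.
The equality is checked after applying `zipTensor`, whose values on pure tensors are explicit. -/
theorem propEdges_eq_sum [DecidableEq (C.Int ⊕ V.Cell)] :
    T.propEdges C = ∑ j : ∀ e, T.PropIndex C e,
      (tprod K fun e => T.propVecFst C e (j e)) ⊗ₜ[K] tprod K fun e => T.propVecSnd C e (j e) := by
  rw [propEdges, LinearEquiv.symm_apply_eq, map_sum]
  simp only [propEdge_one, MultilinearMap.map_sum]
  refine Finset.sum_congr rfl fun j _ => ?_
  change _ = zipTensor _ _ _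
  rw [zipTensor, TensorProduct.lift.tmul, PiTensorProduct.map₂_tprod_tprod]
  rfl

/-- The vector on the side `s` in the summand `j` of the state sum. -/
noncomputable def sideVec (v : ∀ e, T.Fiber (U.label e)) (j : ∀ e, T.PropIndex C e) :
    ∀ s : PolySide U.Cell V.Cell C.Int C.Free, T.sideSpace C s
  | .inl e => T.fiberCast (C.label_in e).symm (v e)
  | .inr (.inl (.inl e)) => T.propVecFst C e (j e)
  | .inr (.inl (.inr e)) => T.propVecSnd C (.inl e) (j (.inl e))
  | .inr (.inr e) => T.propFree C e 1

/-- The vector on each polygon side in the summand `j` of the state sum. -/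
noncomputable def polyVec (v : ∀ e, T.Fiber (U.label e)) (j : ∀ e, T.PropIndex C e) :
    ∀ x, T.Fiber (C.label x) :=
  Equiv.piCongrLeft (fun x => T.Fiber (C.label x)) (Equiv.ofBijective C.place C.place_bij)
    (T.sideVec C v j)

theorem polyVec_place (v : ∀ e, T.Fiber (U.label e)) (j : ∀ e, T.PropIndex C e)
    (s : PolySide U.Cell V.Cell C.Int C.Free) :
    T.polyVec C v j (C.place s) = T.sideVec C v j s :=
  Equiv.piCongrLeft_apply_apply (fun x => T.Fiber (C.label x))
    (Equiv.ofBijective C.place C.place_bij) (T.sideVec C v j) s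

theorem collect_tprod (v : ∀ e, T.Fiber (U.label e)) (j : ∀ e, T.PropIndex C e) :
    T.collect C (((tprod K fun e => T.propVecFst C e (j e)) ⊗ₜ[K]
        tprod K fun e => T.propVecSnd C e (j e)) ⊗ₜ[K] T.propFrees C) =
      (tprod K fun s => T.sideVec C v j (.inr s)) ⊗ₜ[K]
        tprod K fun f => T.propVecSnd C (.inr f) (j (.inr f)) := by
  have h := PiTensorProduct.tmulEquivDep_symm_apply (R := K) (T.propSnd C)
    fun e => T.propVecSnd C e (j e)
  -- The second factors separate here: those of interior edges are the sides `(e, -)` and join `Q`,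
  -- those of out-boundary edges form the output in `T.obj V`.
  have h' : (TensorProduct.congr (LinearEquiv.refl K _)
        (PiTensorProduct.tmulEquivDep K (T.propSnd C)).symm).trans
      (TensorProduct.assoc K _ _ _).symm
      ((tprod K fun e => T.propVecFst C e (j e)) ⊗ₜ[K]
        tprod K fun e => T.propVecSnd C e (j e)) =
      ((tprod K fun e => T.propVecFst C e (j e)) ⊗ₜ[K]
        tprod K fun e => T.propVecSnd C (.inl e) (j (.inl e))) ⊗ₜ[K]
        tprod K fun f => T.propVecSnd C (.inr f) (j (.inr f)) := by
    rw [LinearEquiv.trans_apply, TensorProduct.congr_tmul, h, LinearEquiv.refl_apply,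
      TensorProduct.assoc_symm_tmul]
  rw [collect, LinearEquiv.trans_apply, LinearEquiv.trans_apply,
    TensorProduct.congr_tmul ((TensorProduct.congr _ _).trans _), h', LinearEquiv.refl_apply,
    TensorProduct.rightComm_tmul]
  exact congrArg (· ⊗ₜ[K] _)
    (tmulEquivDep_tmulEquivDep_tprod (M := fun s => T.sideSpace C (.inr s))
      fun s => T.sideVec C v j (.inr s))

theorem evaluation_tprod (v : ∀ e, T.Fiber (U.label e)) (j : ∀ e, T.PropIndex C e) :
    T.evaluation C (tprod K v ⊗ₜ[K] tprod K fun s => T.sideVec C v j (.inr s)) =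
      ∏ P, T.evalGon (C.content P) (tprod K fun i => T.polyVec C v j ⟨P, i⟩) := by
  have h : T.allSides C (tprod K v ⊗ₜ[K] tprod K fun s => T.sideVec C v j (.inr s)) =
      tprod K (T.polyVec C v j) := by
    rw [allSides, LinearEquiv.trans_apply, TensorProduct.congr_tmul, PiTensorProduct.congr_tprod]
    exact reindex_symm_tmulEquivDep_tprod
      (M := fun x => T.Fiber (C.label x)) (Equiv.ofBijective C.place C.place_bij)
      (T.polyVec C v j) _ _ (fun e => T.polyVec_place C v j (.inl e))
      fun s => T.polyVec_place C v j (.inr s)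
  simp only [evaluation, LinearMap.comp_apply, LinearEquiv.coe_coe, h]
  rw [groupTensor, PiTensorProduct.lift.tprod]
  exact mulTensor_map_tprod (fun P => T.evalGon (C.content P)) _

/-- The value of the theory on a surface as a state sum. -/
theorem map_tprod [DecidableEq (C.Int ⊕ V.Cell)] (v : ∀ e, T.Fiber (U.label e)) :
    T.map C (tprod K v) = ∑ j : ∀ e, T.PropIndex C e,
      (∏ P, T.evalGon (C.content P) (tprod K fun i => T.polyVec C v j ⟨P, i⟩)) •
        tprod K fun f => T.propVecSnd C (.inr f) (j (.inr f)) := by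
  simp only [map, LinearMap.comp_apply, LinearEquiv.coe_coe, TensorProduct.rid_symm_apply,
    LinearMap.lTensor_tmul, propagator, LinearMap.toSpanSingleton_apply_one, propEdges_eq_sum,
    TensorProduct.sum_tmul, map_sum, T.collect_tprod C v]
  refine (lid_rTensor_assoc_symm_tmul_sum (T.evaluation C) _ _ _).trans ?_
  simp only [evaluation_tprod]
  rfl

end Expansion

end TrivialSurroundingTheory

/-! ### State sums and removal of a defect-free polygon -/

namespace DefectComplex

variable {D : DefectConditions} {U V : CellFamily D} {C : DefectComplex D U V} {P : C.Poly}

/-- If only the side `(e, -)` lies on `P`, the label is carried across `e`: the inverse of a label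
is `none` only if the label is. -/
theorem posSide_label_eq_none (hP : C.IsDefectFree P) (e : C.Int)
    (he : ¬ ((C.posSide e).1 ≠ P ∧ (C.negSide e).1 ≠ P)) : C.label (C.posSide e) = none := by
  by_cases h : (C.posSide e).1 = P
  · exact hP.label_eq_none_of_fst_eq h
  · have h₁ : C.label (C.negSide e) = none :=
      hP.label_eq_none_of_fst_eq (not_not.1 fun h' => he ⟨h, h'⟩)
    exact Option.map_eq_none_iff.1 ((C.label_neg e).symm.trans h₁)

end DefectComplex

namespace TrivialSurroundingTheory

variable {K : Type u} [Field K] {D : DefectConditions} (T : TrivialSurroundingTheory K D)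
  {U V : CellFamily D} {C : DefectComplex D U V}

theorem propVecFst_eq_unit (e : C.Int ⊕ V.Cell) (j : T.PropIndex C e)
    (h : C.label (C.place (.inr (.inl (.inl e)))) = none) : T.propVecFst C e j = T.unit h := by
  rcases e with e | f
  · exact T.copairingFst_eq_unit h j
  · have h' : V.label f = none := Option.map_eq_none_iff.1 ((C.label_out f).symm.trans h)
    exact (congrArg (T.fiberCast (C.label_out f).symm) (T.copairingSnd_eq_unit h' j)).trans
      (T.fiberCast_unit _ _)

theorem propVecSnd_eq_unit (e : C.Int ⊕ V.Cell) (j : T.PropIndex C e)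
    (h : propSndLabel C e = none) : T.propVecSnd C e j = T.unit h := by
  rcases e with e | f
  · have h' : C.label (C.posSide e) = none :=
      Option.map_eq_none_iff.1 ((C.label_neg e).symm.trans h)
    exact (congrArg (T.fiberCast (C.label_neg e).symm) (T.copairingSnd_eq_unit h' j)).trans
      (T.fiberCast_unit _ _)
  · exact T.copairingFst_eq_unit h j

/-- On interior, out-boundary and free edges the propagators supply the scalar `1`. On in-boundary
cells the vector is an input, hence the condition `hv` for those on `P`. -/
theorem polyVec_eq_unit {P : C.Poly} (hP : C.IsDefectFree P) (v : ∀ e, T.Fiber (U.label e))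
    (hv : ∀ e (h : U.label e = none), ¬ (C.inSide e).1 ≠ P → v e = T.unit h)
    (j : ∀ e, T.PropIndex C e) (i : Fin (C.sides P)) :
    T.polyVec C v j ⟨P, i⟩ = T.unit (hP.label_eq_none i) := by
  obtain ⟨s, hs⟩ := C.place_bij.2 ⟨P, i⟩
  -- The side is made a variable `x`, so that `C.place s = x` can be eliminated although the fiber
  -- depends on it.
  have key : ∀ (x : Σ P, Fin (C.sides P)) (h : C.label x = none), C.place s = x → x.1 = P →
      T.polyVec C v j x = T.unit h := by
    rintro x h rfl hx
    rw [polyVec_place]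
    rcases s with e | (e | e) | e
    · change T.fiberCast (C.label_in e).symm (v e) = _
      rw [hv e ((C.label_in e).symm.trans h) (not_not.2 hx)]
      exact T.fiberCast_unit _ _
    · exact T.propVecFst_eq_unit e _ h
    · exact T.propVecSnd_eq_unit (.inl e) _ h
    · rfl
  exact key _ _ hs rfl

/-! ### Comparison of the state sums with and without `P`. -/

section Remove

variable (P : C.Poly) (hP : C.IsDefectFree P)

/-- The restriction of a summand of the state sum to the edges that are not on `P`. -/
def restrictIndex (j : ∀ e, T.PropIndex C e) : ∀ e, T.PropIndex (C.remove P hP) e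
  | .inl e => j (.inl e.1)
  | .inr f => j (.inr f.1)

/-- The forgotten edges all have a side on `P`, so their index sets have one element. -/
theorem restrictIndex_bijective : Function.Bijective (T.restrictIndex P hP) := by
  classical
  have hInt : ∀ e : C.Int, ¬ ((C.posSide e).1 ≠ P ∧ (C.negSide e).1 ≠ P) →
      Nonempty (Unique (T.PropIndex C (.inl e))) := fun e he =>
    T.nonempty_unique_copairingIndex (DefectComplex.posSide_label_eq_none hP e he)
  have hOut : ∀ f : V.Cell, ¬ (C.outSide f).1 ≠ P →
      Nonempty (Unique (T.PropIndex C (.inr f))) := fun f hf =>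
    T.nonempty_unique_copairingIndex (DefectComplex.outSide_label_eq_none hP f hf)
  constructor
  · intro j j' h
    funext e
    rcases e with e | f
    · by_cases he : (C.posSide e).1 ≠ P ∧ (C.negSide e).1 ≠ P
      · exact congrFun h (.inl ⟨e, he⟩)
      · obtain ⟨_⟩ := hInt e he
        exact Subsingleton.elim _ _
    · by_cases hf : (C.outSide f).1 ≠ P
      · exact congrFun h (.inr ⟨f, hf⟩)
      · obtain ⟨_⟩ := hOut f hf
        exact Subsingleton.elim _ _
  · intro j
    -- The preimage extends `j` by the only index available on each edge at `P`.
    refine ⟨fun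
      | .inl e => if he : (C.posSide e).1 ≠ P ∧ (C.negSide e).1 ≠ P then j (.inl ⟨e, he⟩)
          else (hInt e he).some.default
      | .inr f => if hf : (C.outSide f).1 ≠ P then j (.inr ⟨f, hf⟩)
          else (hOut f hf).some.default, ?_⟩
    funext e
    rcases e with e | f
    · exact dif_pos e.2
    · exact dif_pos f.2

theorem polyVec_remove (v : ∀ e, T.Fiber (U.label e)) (j : ∀ e, T.PropIndex C e)
    (x : Σ P' : (C.remove P hP).Poly, Fin ((C.remove P hP).sides P')) :
    T.polyVec (C.remove P hP) (fun e => v e.1) (T.restrictIndex P hP j) x =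
      T.polyVec C v j ⟨x.1.1, x.2⟩ := by
  obtain ⟨s, rfl⟩ := (C.remove P hP).place_bij.2 x
  refine (T.polyVec_place (C.remove P hP) _ _ s).trans ?_
  -- Up to eta for pairs, the side placed by `s` in the smaller surface is the one placed by
  -- `C.oldSide P s` in `C`.
  refine Eq.trans ?_ (T.polyVec_place C v j (C.oldSide P s)).symm
  rcases s with e | ((e | f) | e) | e | e | e
  · rfl
  · rfl
  · rfl
  · rfl
  · rfl
  -- The last two cases are the edges shared with `P`, with `(e, +)` or `(e, -)` remaining. They are
  -- free after the removal and carry the truncated propagator; in `C` they carry a factor of `1 ⊗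
  -- 1`.
  · exact (T.propVecFst_eq_unit (.inl e.1) _
      (DefectComplex.posSide_label_eq_none hP e.1 fun h => h.2 e.2.2)).symm
  · exact (T.propVecSnd_eq_unit (.inl e.1) _
      ((C.remove P hP).label_free (.inr (.inr e)))).symm

/-- Removing a defect-free polygon does not change the value of the theory on a surface. -/
theorem map_remove :
    (T.objRestrict V (fun f => (C.outSide f).1 ≠ P)
          (DefectComplex.outSide_label_eq_none hP)).toLinearMap ∘ₗ
        T.map C ∘ₗ
        (T.objRestrict U (fun e => (C.inSide e).1 ≠ P)
          (DefectComplex.inSide_label_eq_none hP)).symm.toLinearMap =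
      T.map (C.remove P hP) := by
  classical
  refine PiTensorProduct.ext (MultilinearMap.ext fun w => ?_)
  -- The input `w` is extended by `1` on the cells on `P`, which gives its preimage under the
  -- identification. Afterwards `v` is made opaque, so that `w` can be replaced by the restriction
  -- of `v`.
  let v : ∀ e, T.Fiber (U.label e) := fun e =>
    if he : (C.inSide e).1 ≠ P then w ⟨e, he⟩
    else T.unit (DefectComplex.inSide_label_eq_none hP e he)
  have hv : ∀ e (he : ¬ (C.inSide e).1 ≠ P),
      v e = T.unit (DefectComplex.inSide_label_eq_none hP e he) := fun e he => dif_neg he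
  have hw : ∀ e (he : (C.inSide e).1 ≠ P), v e = w ⟨e, he⟩ := fun e he => dif_pos he
  clear_value v
  obtain rfl : w = fun e : {e // (C.inSide e).1 ≠ P} => v e.1 :=
    funext fun e => (hw e.1 e.2).symm
  have h : (T.objRestrict U (fun e => (C.inSide e).1 ≠ P)
      (DefectComplex.inSide_label_eq_none hP)).symm (tprod K fun e => v e.1) = tprod K v :=
    (LinearEquiv.symm_apply_eq _).2 (T.objRestrict_tprod _ _ _ v hv).symm
  refine (congrArg (fun x => T.objRestrict V (fun f => (C.outSide f).1 ≠ P)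
    (DefectComplex.outSide_label_eq_none hP) (T.map C x)) h).trans ?_
  rw [map_tprod]
  refine (map_sum _ _ _).trans ?_
  refine Eq.trans ?_ (T.map_tprod (C.remove P hP) fun e => v e.1).symm
  refine Fintype.sum_bijective _ (T.restrictIndex_bijective P hP) _ _ fun j => ?_
  refine (map_smul _ _ _).trans ?_
  refine (congrArg _ (T.objRestrict_tprod V _ _ _ fun f hf =>
    T.propVecSnd_eq_unit (.inr f) _ (DefectComplex.outSide_label_eq_none hP f hf))).trans ?_
  have hprod : ∏ P', T.evalGon (C.content P') (tprod K fun i => T.polyVec C v j ⟨P', i⟩) =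
      ∏ P', T.evalGon ((C.remove P hP).content P') (tprod K fun i =>
        T.polyVec (C.remove P hP) (fun e => v e.1) (T.restrictIndex P hP j) ⟨P', i⟩) := by
    -- The factor of `P` is split off and equals `1`.
    rw [Fintype.prod_eq_mul_prod_subtype_ne _ P, T.evalGon_unit _ (hP.label_eq_none ·) _
      (T.polyVec_eq_unit hP v (fun e _ he => hv e he) j), one_mul]
    simp only [polyVec_remove]
    -- Both products run over the same subtype, but with different `Fintype` instances; the identity
    -- equivalence relates them.
    exact @Fintype.prod_equiv {P' // P' ≠ P} (C.remove P hP).Poly K _ _ _ (Equiv.refl _) _ _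
      fun _ => rfl
  rw [hprod]
  rfl

end Remove

end TrivialSurroundingTheory

theorem mainTheorem9 {K : Type*} [Field K] {D : DefectConditions}
    (T : TrivialSurroundingTheory K D) {U V : DefectCircles D} (C : DefectBordism U V)
    (hC : C.IsCylinder) (S : PolygonSplit C) :
    (T.objRestrict V.cells (fun f => (C.outSide f).1 ≠ S.hat)
          (DefectComplex.outSide_label_eq_none S.defectFree)).toLinearMap ∘ₗ
        T.map C.toDefectComplex ∘ₗ
        (T.objRestrict U.cells (fun e => (C.inSide e).1 ≠ S.hat)
          (DefectComplex.inSide_label_eq_none S.defectFree)).symm.toLinearMap =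
      T.map S.rest :=
  T.map_remove S.hat S.defectFree
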